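/- Let $(\mathcal M,d)$ be a complete NPC space. That is, $(\mathcal M,d)$ is a complete metric space; any two points $x,y$ are joined by a geodesic, i.e. a path $\gamma:[0,1]\to\mathcal M$ with $\gamma(0)=x$, $\gamma(1)=y$ and $d(\gamma(s),\gamma(t))=(t-s)\,d(x,y)$ for $0\le s\le t\le 1$; and for every $p\in\mathcal M$, every geodesic $\gamma$ from $x$ to $y$ and every $t\in[0,1]$, $$d^2(p,\gamma(t))\le(1-t)\,d^2(p,x)+t\,d^2(p,y)-t(1-t)\,d^2(x,y).$$ Let $\mathcal Z$ be a measurable space, $\Theta\subset\mathcal M$, and let $\ell:\mathcal M\times\mathcal Z\to\mathbb R$ be a measurable loss such that, for every $z\in\mathcal Z$, the function $\ell(\cdot,z)$ is lower semicontinuous and geodesically convex (i.e. $t\mapsto\ell(\gamma(t),z)$ is convex on $[0,1]$ for every geodesic $\gamma$). Let $(\hat m_t)_{t\ge1}$ be a prediction strategy: $\hat m_1=m_1\in\mathcal M$ is a constant and $\hat m_t=m_t(z_1,\dots,z_{t-1})$ with $m_t:\mathcal Z^{t-1}\to\mathcal M$ measurable for $t\ge2$. Suppose that for every $T\ge1$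 there is a real constant $B_T$ such that, for all $(z_1,\dots,z_T)\in\mathcal Z^T$, $$\sum_{t=1}^T\ell(\hat m_t,z_t)-\inf_{\theta\in\Theta}\sum_{t=1}^T\ell(\theta,z_t)\le B_T .$$ Let $n\ge1$, let $Z_1,\dots,Z_n$ be i.i.d. $\mathcal Z$-valued random variables with the same distribution as, and independent from, a random variable $Z$, and let $\theta_n$ be the barycenter of the random probability measure $$\frac1{n+1}\,\delta_{m_1}+\frac1{n+1}\sum_{i=2}^{n+1}\delta_{m_i(Z_1,\dots,Z_{i-1})},$$ i.e. the minimizer over $m\in\mathcal M$ of $d^2(m,m_1)+\sum_{i=2}^{n+1}d^2(m,m_i(Z_1,\dots,Z_{i-1}))$. Assume that $\ell(\theta_n,Z)$ and $\ell(\theta,Z)$, for every $\theta\in\Theta$, are integrable. Then $$\mathbb E[\ell(\theta_n,Z)]-\inf_{\theta\in\Theta}\mathbb E[\ell(\theta,Z)]\le\frac{B_{n+1}}{n+1}.$$ (Infima and differences are taken in $[-\infty,+\infty]$; in particular the infimum of the expectations is not $-\infty$.) -/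

import Mathlib

open MeasureTheory ProbabilityTheory

noncomputable section

namespace NPC

section Geometry

variable {M : Type*} [MetricSpace M]

/-- `γ` (restricted to `[0, 1]`) is a constant speed minimizing geodesic from `γ 0` to `γ 1`.
The values of `γ` outside `[0, 1]` play no role. -/
def IsGeodesic (γ : ℝ → M) : Prop :=
  ∀ s t : ℝ, 0 ≤ s → s ≤ t → t ≤ 1 → dist (γ s) (γ t) = (t - s) * dist (γ 0) (γ 1)

/-- `f` is convex along every geodesic. -/
def GeodesicallyConvex (f : M → ℝ) : Prop :=
  ∀ γ : ℝ → M, IsGeodesic γ → ConvexOn ℝ (Set.Icc 0 1) (fun t => f (γ t))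

variable (M) in
/-- A geodesic space of non-positive curvature (completeness is a separate assumption). -/
structure IsNPC : Prop where
  exists_geodesic : ∀ x y : M, ∃ γ : ℝ → M, IsGeodesic γ ∧ γ 0 = x ∧ γ 1 = y
  dist_sq_le : ∀ (p : M) (γ : ℝ → M), IsGeodesic γ → ∀ t ∈ Set.Icc (0 : ℝ) 1,
    dist p (γ t) ^ 2 ≤
      (1 - t) * dist p (γ 0) ^ 2 + t * dist p (γ 1) ^ 2 - t * (1 - t) * dist (γ 0) (γ 1) ^ 2

variable [MeasurableSpace M]

/-- `P` is a probability measure with finite second moments. -/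
def MemP2 (P : Measure M) : Prop :=
  IsProbabilityMeasure P ∧ ∀ x : M, Integrable (fun y => dist x y ^ 2) P

/-- `b` is a barycenter (Fréchet mean) of the probability measure `P`. -/
def IsBarycenter (P : Measure M) (b : M) : Prop :=
  MemP2 P ∧ ∀ x : M, ∫ y, dist b y ^ 2 ∂P ≤ ∫ y, dist x y ^ 2 ∂P

/-- The uniform probability measure on the points `x 0, …, x n`, counted with multiplicity. -/
def empiricalMeasure {n : ℕ} (x : Fin (n + 1) → M) : Measure M :=
  ((n : ENNReal) + 1)⁻¹ • ∑ i, Measure.dirac (x i)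

end Geometry

section Online

variable {M 𝒵 : Type*}

/-- A prediction strategy against constant experts: `m t` maps the `t` outcomes observed so far
to the prediction for round `t + 1`. In particular `m 0` is a single point of `M`. -/
abbrev Strategy (M 𝒵 : Type*) := (t : ℕ) → (Fin t → 𝒵) → M

/-- The first `t` entries of the sequence `z`. -/
def past {T : ℕ} (z : Fin T → 𝒵) {t : ℕ} (h : t ≤ T) : Fin t → 𝒵 :=
  fun s => z (Fin.castLE h s)

/-- The `n + 1` predictions that the strategy makes while `z 0, …, z (n - 1)` are revealed. -/
def predictions (m : Strategy M 𝒵) {n : ℕ} (z : Fin n → 𝒵) (t : Fin (n + 1)) : M :=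
  m t (past z (Nat.le_of_lt_succ t.isLt))

/-- The regret of the strategy `m` after the outcomes `z 0, …, z (T - 1)`, against the constant
experts in `Θ`. It is `⊤` if the cumulative losses of the experts are not bounded below. -/
def regret (ℓ : M → 𝒵 → ℝ) (Θ : Set M) (m : Strategy M 𝒵) {T : ℕ} (z : Fin T → 𝒵) : EReal :=
  ((∑ t : Fin T, ℓ (m t (past z t.isLt.le)) (z t) : ℝ) : EReal) -
    ⨅ θ ∈ Θ, ((∑ t : Fin T, ℓ θ (z t) : ℝ) : EReal)

end Online

end NPC

end

/-! This is an online-to-batch conversion. Fix `θ ∈ Θ` and let `h t` be the excess loss over `θ` of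
the prediction made after `t` outcomes. Jensen's inequality for the barycenter bounds `n + 1` times
the excess loss of `θn` at `Z` by the sum of the `h t` at `Z`. Each prediction depends only on
earlier data, so replacing `Z` in each term by the next observation should preserve the expectation
and produce a regret, at most `B (n + 1)`.

`jensen_barycenter` works in the product of `M` with the line: the barycenter of the points `(x i, f
(x i))` lies at distance zero from the epigraph, a geodesically convex set containing them.

The terms `h t` need not be integrable jointly in past and outcome, so the exchange is one-sided:
coordinates are integrated out one by one under an integrable majorant
(`integral_nonneg_of_sum_centered_le`), after truncating the sum from above. -/

namespace NPC

/-! ### Jensen's inequality in NPC spaces -/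

section Jensen

variable {M : Type*} [MetricSpace M]

/-- The squared distance from `(b, c)` to the points of the epigraph of `f`, in the product of
`M` with the real line, satisfies the inequality of non-positive curvature. -/
lemma iInf_epigraph_le (hM : IsNPC M) {f : M → ℝ} (hf : GeodesicallyConvex f) (b : M) (c : ℝ)
    {y : M} {s : ℝ} (hys : f y ≤ s) (x : M) {t : ℝ} (ht : t ∈ Set.Icc (0 : ℝ) 1) :
    ⨅ q : {q : M × ℝ // f q.1 ≤ q.2}, (dist b q.1.1 ^ 2 + (c - q.1.2) ^ 2) ≤
      (1 - t) * (dist b y ^ 2 + (c - s) ^ 2) + t * (dist b x ^ 2 + (c - f x) ^ 2)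
        - t * (1 - t) * (dist y x ^ 2 + (s - f x) ^ 2) := by
  obtain ⟨γ, hγ, rfl, rfl⟩ := hM.exists_geodesic y x
  have hconv := (hf γ hγ).2 (Set.left_mem_Icc.2 zero_le_one) (Set.right_mem_Icc.2 zero_le_one)
    (sub_nonneg.2 ht.2) ht.1 (by ring)
  simp only [smul_eq_mul, mul_zero, mul_one, zero_add] at hconv
  have hmem : f (γ t) ≤ (1 - t) * s + t * f (γ 1) := by
    have := mul_le_mul_of_nonneg_left hys (sub_nonneg.2 ht.2)
    linarith
  have hbdd : BddBelow (Set.range fun q : {q : M × ℝ // f q.1 ≤ q.2} =>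
      dist b q.1.1 ^ 2 + (c - q.1.2) ^ 2) :=
    ⟨0, by rintro _ ⟨q, rfl⟩; positivity⟩
  have h1 := ciInf_le hbdd ⟨(γ t, (1 - t) * s + t * f (γ 1)), hmem⟩
  have h2 := hM.dist_sq_le b γ hγ t ht
  refine h1.trans ?_
  simp only
  linarith

/-- Jensen's inequality for the barycenter of finitely many points. -/
theorem jensen_barycenter (hM : IsNPC M) {f : M → ℝ} (hlsc : LowerSemicontinuous f)
    (hf : GeodesicallyConvex f) {ι : Type*} [Fintype ι] [Nonempty ι] (x : ι → M) (b : M)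
    (hb : ∀ y, ∑ i, dist b (x i) ^ 2 ≤ ∑ i, dist y (x i) ^ 2) :
    Fintype.card ι * f b ≤ ∑ i, f (x i) := by
  have hN : (0 : ℝ) < Fintype.card ι := by exact_mod_cast Fintype.card_pos
  set N : ℝ := (Fintype.card ι : ℝ)
  set c : ℝ := (∑ i, f (x i)) / N with hc
  have hNc : ∑ i, f (x i) = N * c := by rw [hc]; field_simp
  suffices f b ≤ c by rw [hNc]; exact mul_le_mul_of_nonneg_left this hN.le
  set φ : {q : M × ℝ // f q.1 ≤ q.2} → ℝ :=
    fun q => dist b q.1.1 ^ 2 + (c - q.1.2) ^ 2 with hφ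
  have : Nonempty {q : M × ℝ // f q.1 ≤ q.2} := ⟨⟨(b, f b), le_rfl⟩⟩
  set D : ℝ := ⨅ q, φ q with hD
  set V : ℝ := ∑ i, (dist b (x i) ^ 2 + (c - f (x i)) ^ 2) with hV
  have hconst : ∀ r : ℝ, ∑ _i : ι, r = N * r := fun r => by
    rw [Finset.sum_const, Finset.card_univ, nsmul_eq_mul]
  -- As `c` is the mean of the values, `(b, c)` is the barycenter of the points `(x i, f (x i))` in
  -- the product.
  have hVle : ∀ (y : M) (s : ℝ), V ≤ ∑ i, (dist y (x i) ^ 2 + (s - f (x i)) ^ 2) := by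
    intro y s
    have h1 : ∑ i, (s - f (x i)) ^ 2 - ∑ i, (c - f (x i)) ^ 2 = N * (s - c) ^ 2 := by
      rw [← Finset.sum_sub_distrib]
      calc ∑ i, ((s - f (x i)) ^ 2 - (c - f (x i)) ^ 2)
          = ∑ i, ((s ^ 2 - c ^ 2) - 2 * (s - c) * f (x i)) :=
            Finset.sum_congr rfl fun i _ => by ring
        _ = N * (s - c) ^ 2 := by
            rw [Finset.sum_sub_distrib, ← Finset.mul_sum, hNc, hconst]; ring
    have h2 : 0 ≤ N * (s - c) ^ 2 := by positivity
    rw [hV, Finset.sum_add_distrib, Finset.sum_add_distrib]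
    linarith [hb y]
  have hkey : ∀ t ∈ Set.Ioo (0 : ℝ) 1, N * D ≤ t * V := by
    rintro t ⟨ht0, ht1⟩
    have hq : ∀ q, (N * D - t ^ 2 * V) / ((1 - t) * N) ≤ φ q := by
      rintro ⟨⟨y, s⟩, hys⟩
      -- Move `(y, s)` a fraction `t` towards each `(x i, f (x i))` and sum; by `hVle` the curvature
      -- terms total at most `-t (1 - t) V`, which leaves `N D ≤ (1 - t) N φ(y, s) + t² V`.
      have hsum := Finset.sum_le_sum fun i (_ : i ∈ Finset.univ) =>
        iInf_epigraph_le hM hf b c hys (x i) ⟨ht0.le, ht1.le⟩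
      rw [hconst, Finset.sum_sub_distrib, Finset.sum_add_distrib, hconst, ← Finset.mul_sum,
        ← Finset.mul_sum] at hsum
      have h3 := mul_le_mul_of_nonneg_left (hVle y s) (mul_nonneg ht0.le (sub_nonneg.2 ht1.le))
      rw [div_le_iff₀ (mul_pos (sub_pos.2 ht1) hN)]
      change N * D ≤ _ at hsum
      simp only [hφ]
      linarith
    have h4 := le_ciInf hq
    rw [div_le_iff₀ (mul_pos (sub_pos.2 ht1) hN)] at h4
    have h5 : t * (N * D) ≤ t * (t * V) := by
      change _ ≤ D * _ at h4
      linarith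
    exact le_of_mul_le_mul_left h5 ht0
  have hD0 : D ≤ 0 := by
    have hlim : Filter.Tendsto (fun t : ℝ => t * V) (nhdsWithin 0 (Set.Ioi 0)) (nhds 0) := by
      have : Continuous fun t : ℝ => t * V := by fun_prop
      simpa using (this.tendsto 0).mono_left nhdsWithin_le_nhds
    have h6 : N * D ≤ 0 := ge_of_tendsto hlim
      (Filter.mem_of_superset (Ioo_mem_nhdsGT zero_lt_one) hkey)
    exact nonpos_of_mul_nonpos_right h6 hN
  by_contra! hlt
  -- Since `D ≤ 0`, the epigraph has points `(y, s)` arbitrarily close to `(b, c)`. Near `b`, `f`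
  -- exceeds the midpoint of `c` and `f b`, while `f y ≤ s` stays below it.
  obtain ⟨δ, hδ, hball⟩ := Metric.eventually_nhds_iff.1 (hlsc b ((c + f b) / 2) (by linarith))
  have hε : 0 < min δ ((f b - c) / 2) := lt_min hδ (by linarith)
  set ε := min δ ((f b - c) / 2)
  obtain ⟨⟨⟨y, s⟩, hys⟩, hlt'⟩ := exists_lt_of_ciInf_lt (hD0.trans_lt (pow_pos hε 2))
  simp only [hφ] at hlt' hys
  have hdist : dist y b < ε := by
    rw [dist_comm]
    exact lt_of_pow_lt_pow_left₀ 2 hε.le (by nlinarith [sq_nonneg (c - s)])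
  have hs : s - c < ε := (le_abs_self _).trans_lt (abs_lt_of_sq_lt_sq
    (by nlinarith [sq_nonneg (dist b y)] : (s - c) ^ 2 < ε ^ 2) hε.le)
  have := hball (hdist.trans_le (min_le_left _ _))
  have := min_le_right δ ((f b - c) / 2)
  linarith

end Jensen

section Empirical

variable {M : Type*} [MetricSpace M] [MeasurableSpace M] [BorelSpace M]

lemma integral_empiricalMeasure {n : ℕ} (x : Fin (n + 1) → M) (f : M → ℝ) :
    ∫ y, f y ∂(empiricalMeasure x) = ((n : ℝ) + 1)⁻¹ * ∑ i, f (x i) := by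
  rw [empiricalMeasure, integral_smul_measure,
    integral_finsetSum_measure fun i _ => integrable_dirac (by simp)]
  simp only [integral_dirac, smul_eq_mul]
  congr 1
  rw [ENNReal.toReal_inv]
  norm_cast

lemma IsBarycenter.sum_dist_sq_le {n : ℕ} {x : Fin (n + 1) → M} {b : M}
    (hb : IsBarycenter (empiricalMeasure x) b) (y : M) :
    ∑ i, dist b (x i) ^ 2 ≤ ∑ i, dist y (x i) ^ 2 := by
  have h := hb.2 y
  rw [integral_empiricalMeasure, integral_empiricalMeasure] at h
  exact le_of_mul_le_mul_left h (by positivity)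

end Empirical

/-! ### Exchanging the fresh outcome with the observed ones -/

section Martingale

variable {𝒵 : Type*}

lemma past_snoc {N : ℕ} (x : Fin N → 𝒵) (z : 𝒵) {t : ℕ} (h : t ≤ N) (h' : t ≤ N + 1) :
    past (Fin.snoc x z : Fin (N + 1) → 𝒵) h' = past x h := by
  funext s
  exact Fin.snoc_castSucc (α := fun _ => 𝒵) z x (Fin.castLE h s)

lemma past_self {N : ℕ} (x : Fin N → 𝒵) (h : N ≤ N) : past x h = x := rfl

variable [MeasurableSpace 𝒵]

lemma measurable_past {N t : ℕ} (h : t ≤ N) :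
    Measurable fun x : Fin N → 𝒵 => past x h :=
  measurable_pi_lambda _ fun _ => measurable_pi_apply _

variable (ν : Measure 𝒵) [IsProbabilityMeasure ν]

lemma measurePreserving_snoc (N : ℕ) :
    MeasurePreserving (fun p : (Fin N → 𝒵) × 𝒵 => (Fin.snoc p.1 p.2 : Fin (N + 1) → 𝒵))
      ((Measure.pi fun _ => ν).prod ν) (Measure.pi fun _ => ν) := by
  have h1 := (measurePreserving_piFinSuccAbove (fun _ : Fin (N + 1) => ν) (Fin.last N)).symm
  have h2 := h1.comp (Measure.measurePreserving_swap (μ := Measure.pi fun _ : Fin N => ν) (ν := ν))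
  convert h2 using 1
  funext p
  simp [MeasurableEquiv.piFinSuccAbove, Fin.insertNthEquiv, Fin.insertNth_last']

/-- A sum of conditionally centered terms that is dominated by an integrable function forces
the integral of that function to be nonnegative, even if the terms are not integrable. -/
theorem integral_nonneg_of_sum_centered_le (d : (t : ℕ) → (Fin t → 𝒵) → 𝒵 → ℝ) (N : ℕ)
    (Φ : (Fin N → 𝒵) → ℝ) (hΦ : Integrable Φ (Measure.pi fun _ => ν))
    (hd : ∀ᵐ x ∂(Measure.pi fun _ : Fin N => ν),
      ∀ t : Fin N, Integrable (d t (past x t.isLt.le)) ν)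
    (hle : ∀ᵐ x ∂(Measure.pi fun _ : Fin N => ν),
      ∑ t : Fin N, (d t (past x t.isLt.le) (x t) - ∫ z, d t (past x t.isLt.le) z ∂ν) ≤ Φ x) :
    0 ≤ ∫ x, Φ x ∂(Measure.pi fun _ => ν) := by
  induction N with
  | zero => exact integral_nonneg_of_ae (by filter_upwards [hle] with x hx; simpa using hx)
  | succ N ih =>
    have hmp := measurePreserving_snoc ν N
    have hΦ' := hmp.integrable_comp_of_integrable hΦ
    have hint : ∫ x, ∫ z, Φ (Fin.snoc x z) ∂ν ∂(Measure.pi fun _ : Fin N => ν) =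
        ∫ x, Φ x ∂(Measure.pi fun _ => ν) := by
      rw [integral_integral (f := fun x z => Φ (Fin.snoc x z)) hΦ', ← hmp.map_eq,
        integral_map hmp.measurable.aemeasurable (by rw [hmp.map_eq]; exact hΦ.1)]
    have hd' := Measure.ae_ae_of_ae_prod (hmp.quasiMeasurePreserving.ae hd)
    have hle' := Measure.ae_ae_of_ae_prod (hmp.quasiMeasurePreserving.ae hle)
    have hd2 : ∀ᵐ x ∂(Measure.pi fun _ : Fin N => ν),
        ∀ t : Fin (N + 1), Integrable (d t (past x (Nat.le_of_lt_succ t.isLt))) ν := by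
      -- The pasts involved do not see the last coordinate, so a single good `z` suffices.
      filter_upwards [hd'] with x hx t
      obtain ⟨z, hz⟩ := hx.exists
      have := hz t
      rwa [past_snoc x z (Nat.le_of_lt_succ t.isLt)] at this
    rw [← hint]
    refine ih _ hΦ'.integral_prod_left ?_ ?_
    · filter_upwards [hd2] with x hx t using hx t.castSucc
    · filter_upwards [hd2, hle', hΦ'.prod_right_ae] with x hx hxle hxΦ
      have hlast : Integrable (d N x) ν := hx (Fin.last N)
      set S := ∑ t : Fin N, (d t (past x t.isLt.le) (x t) - ∫ z, d t (past x t.isLt.le) z ∂ν)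
      -- Given `x`, the last centered term integrates to zero, so the remaining sum `S` is dominated
      -- by the partial integral of `Φ`.
      have hmono : ∫ z, ((S - ∫ w, d N x w ∂ν) + d N x z) ∂ν ≤ ∫ z, Φ (Fin.snoc x z) ∂ν := by
        refine integral_mono_ae ((integrable_const _).add hlast) hxΦ ?_
        filter_upwards [hxle] with z hz
        rw [Fin.sum_univ_castSucc] at hz
        simp only [Fin.val_castSucc, Fin.val_last, Fin.snoc_castSucc, Fin.snoc_last] at hz
        rw [past_snoc x z le_rfl, past_self] at hz
        have hS : S = ∑ t : Fin N, (d t (past (Fin.snoc x z : Fin (N + 1) → 𝒵)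
            (t.castSucc.isLt.le)) (x t) - ∫ w, d t (past (Fin.snoc x z : Fin (N + 1) → 𝒵)
            (t.castSucc.isLt.le)) w ∂ν) :=
          Finset.sum_congr rfl fun t _ => by
            rw [past_snoc x z t.isLt.le]
        rw [hS]
        refine le_trans (le_of_eq ?_) hz
        ring
      rw [integral_add (integrable_const _) hlast] at hmono
      simpa using hmono

/-- If the partial sums of `h` along every sequence are bounded above, then the expectation of any
integrable lower bound of `∑ t, h t (x 0, …, x (t - 1)) z` is bounded by the last of these
bounds: passing from on-line to batch performance. -/
theorem integral_le_of_partial_sums_le (h : (t : ℕ) → (Fin t → 𝒵) → 𝒵 → ℝ)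
    (hmeas : ∀ t x, Measurable (h t x)) (B : ℕ → ℝ)
    (hB : ∀ T : ℕ, 1 ≤ T → ∀ z : Fin T → 𝒵, ∑ t : Fin T, h t (past z t.isLt.le) (z t) ≤ B T)
    (n : ℕ) (v : (Fin n → 𝒵) × 𝒵 → ℝ)
    (hv : Integrable v ((Measure.pi fun _ => ν).prod ν))
    (hvle : ∀ x z, v (x, z) ≤
      ∑ t : Fin (n + 1), h t (past x (Nat.le_of_lt_succ t.isLt)) z) :
    ∫ p, v p ∂((Measure.pi fun _ => ν).prod ν) ≤ B (n + 1) := by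
  have hstep : ∀ (t : ℕ) (x : Fin t → 𝒵) (z : 𝒵),
      ∑ s : Fin t, h s (past x s.isLt.le) (x s) + h t x z ≤ B (t + 1) := by
    intro t x z
    have := hB (t + 1) (Nat.le_add_left _ _) (Fin.snoc x z)
    rw [Fin.sum_univ_castSucc] at this
    simp only [Fin.val_castSucc, Fin.val_last, Fin.snoc_castSucc, Fin.snoc_last] at this
    rw [past_snoc x z le_rfl, past_self] at this
    convert this using 4 with s
    rw [past_snoc x z s.isLt.le]
  have hup : ∀ (t : ℕ) (x : Fin t → 𝒵), ∃ C, ∀ z, h t x z ≤ C := fun t x =>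
    ⟨B (t + 1) - ∑ s : Fin t, h s (past x s.isLt.le) (x s), fun z => by
      linarith [hstep t x z]⟩
  choose C hC using hup
  -- With the past frozen, the bound `B (t + 1)` caps each term from above. The integrable `v`
  -- bounds the sum from below, hence also each single term.
  have hint : ∀ᵐ x ∂(Measure.pi fun _ : Fin n => ν),
      ∀ t : Fin (n + 1), Integrable (h t (past x (Nat.le_of_lt_succ t.isLt))) ν := by
    filter_upwards [hv.prod_right_ae] with x hx t
    refine integrable_of_le_of_le (hmeas _ _).aestronglyMeasurable
      (g₁ := fun z => v (x, z) - ∑ s ∈ Finset.univ.erase t,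
        C s (past x (Nat.le_of_lt_succ s.isLt))) (g₂ := fun _ => C t (past x _))
      (Filter.Eventually.of_forall fun z => ?_) (Filter.Eventually.of_forall (hC _ _))
      (hx.sub (integrable_const _)) (integrable_const _)
    have h1 := hvle x z
    rw [← Finset.add_sum_erase _ _ (Finset.mem_univ t)] at h1
    have h2 := Finset.sum_le_sum fun s (_ : s ∈ Finset.univ.erase t) =>
      hC s (past x (Nat.le_of_lt_succ s.isLt)) z
    simp only
    linarith
  have hnonneg := integral_nonneg_of_sum_centered_le ν h n
    (fun x => B (n + 1) - ∫ z, v (x, z) ∂ν) ((integrable_const _).sub hv.integral_prod_left)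
    (by filter_upwards [hint] with x hx t using hx t.castSucc) (by
      filter_upwards [hint, hv.prod_right_ae] with x hx hxv
      have hlast : Integrable (h n x) ν := hx (Fin.last n)
      -- `h1` bounds the observed terms plus the mean of the last one by `B (n + 1)`; `h2` bounds
      -- the sum of all `n + 1` means below by the integral of `v`. Subtracting gives the required
      -- domination.
      have h1 := integral_mono ((integrable_const _).add hlast) (integrable_const _) (hstep n x)
      have h2 := integral_mono hxv (integrable_finsetSum Finset.univ fun t _ => hx t) (hvle x)
      rw [integral_finsetSum _ fun t _ => hx t, Fin.sum_univ_castSucc] at h2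
      simp only [Fin.val_castSucc, Fin.val_last, past_self] at h2
      simp only [Pi.add_apply] at h1
      rw [integral_add (integrable_const _) hlast] at h1
      simp only [integral_const, probReal_univ, one_smul] at h1
      rw [Finset.sum_sub_distrib]
      linarith)
  rw [integral_sub (integrable_const _) hv.integral_prod_left] at hnonneg
  simp only [integral_const, probReal_univ, one_smul] at hnonneg
  rw [integral_prod _ hv]
  linarith

end Martingale

lemma sum_sub_le_of_regret_le {M 𝒵 : Type*} {ℓ : M → 𝒵 → ℝ} {Θ : Set M} {m : Strategy M 𝒵}
    {T : ℕ} {z : Fin T → 𝒵} {b : ℝ} (h : regret ℓ Θ m z ≤ (b : EReal)) {θ : M} (hθ : θ ∈ Θ) :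
    ∑ t : Fin T, (ℓ (m t (past z t.isLt.le)) (z t) - ℓ θ (z t)) ≤ b := by
  rw [regret] at h
  have h1 : ⨅ θ ∈ Θ, ((∑ t : Fin T, ℓ θ (z t) : ℝ) : EReal) ≤
      ((∑ t : Fin T, ℓ θ (z t) : ℝ) : EReal) := iInf₂_le θ hθ
  have h2 := (EReal.sub_le_sub le_rfl h1).trans h
  rw [← EReal.coe_sub, EReal.coe_le_coe_iff] at h2
  rwa [Finset.sum_sub_distrib]

/-- Truncating from above is enough to bound an integral. -/
lemma integral_le_of_integral_min_le {Ω : Type*} [MeasurableSpace Ω] {μ : Measure Ω}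
    [IsFiniteMeasure μ] {f : Ω → ℝ} (hf : Integrable f μ) {b : ℝ}
    (h : ∀ c : ℕ, ∫ ω, min (f ω) c ∂μ ≤ b) : ∫ ω, f ω ∂μ ≤ b := by
  refine le_of_tendsto' (tendsto_integral_of_dominated_convergence (fun ω => |f ω|)
    (F := fun (c : ℕ) ω => min (f ω) c)
    (fun c => (hf.inf (integrable_const _)).1) hf.abs (fun c => ?_) ?_) h
  · filter_upwards with ω
    have hc : (0 : ℝ) ≤ c := c.cast_nonneg
    rw [Real.norm_eq_abs, abs_le]
    refine ⟨le_min (neg_abs_le _) ?_, (min_le_left _ _).trans (le_abs_self _)⟩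
    linarith [abs_nonneg (f ω)]
  · filter_upwards with ω
    obtain ⟨N, hN⟩ := exists_nat_ge (f ω)
    refine tendsto_const_nhds.congr' ?_
    filter_upwards [Filter.eventually_ge_atTop N] with c hc
    exact (min_eq_left (hN.trans (by exact_mod_cast hc))).symm

end NPC

/-! ### From regret to expected loss -/

theorem mainTheorem2
    {M : Type*} [MetricSpace M] [CompleteSpace M] [MeasurableSpace M] [BorelSpace M]
    {𝒵 : Type*} [MeasurableSpace 𝒵]
    {Ω : Type*} [MeasurableSpace Ω] (μ : Measure Ω) [IsProbabilityMeasure μ]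
    (hM : NPC.IsNPC M)
    (ℓ : M → 𝒵 → ℝ) (Θ : Set M) (m : NPC.Strategy M 𝒵) (B : ℕ → ℝ)
    -- the loss is measurable, and lower semicontinuous and geodesically convex in the prediction
    (hℓ_meas : Measurable (Function.uncurry ℓ))
    (hℓ_lsc : ∀ z, LowerSemicontinuous (fun x => ℓ x z))
    (hℓ_conv : ∀ z, NPC.GeodesicallyConvex (fun x => ℓ x z))
    -- the strategy is measurable and has regret at most `B T` on every outcome sequence
    (hm_meas : ∀ t, Measurable (m t))
    (hregret : ∀ T : ℕ, 1 ≤ T → ∀ z : Fin T → 𝒵, NPC.regret ℓ Θ m z ≤ ((B T : ℝ) : EReal))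
    -- i.i.d. data `X 0, …, X (n - 1)`, and an independent copy `Z`
    (n : ℕ) (hn : 1 ≤ n) (X : Fin n → Ω → 𝒵) (Z : Ω → 𝒵)
    (hX_meas : ∀ i, Measurable (X i)) (hZ_meas : Measurable Z)
    (hX_indep : iIndepFun X μ) (hXZ_indep : IndepFun (fun ω i => X i ω) Z μ)
    (hX_ident : ∀ i, IdentDistrib (X i) Z μ μ)
    -- the estimator: the barycenter of the `n + 1` predictions computed on the data
    (θn : Ω → M)
    (hθn : ∀ ω, NPC.IsBarycenter
      (NPC.empiricalMeasure (NPC.predictions m (fun i => X i ω))) (θn ω))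
    -- the expectations in the conclusion are well defined
    (hΘ_int : ∀ θ ∈ Θ, Integrable (fun ω => ℓ θ (Z ω)) μ)
    (hθn_int : Integrable (fun ω => ℓ (θn ω) (Z ω)) μ) :
    ((∫ ω, ℓ (θn ω) (Z ω) ∂μ : ℝ) : EReal)
        - ⨅ θ ∈ Θ, ((∫ ω, ℓ θ (Z ω) ∂μ : ℝ) : EReal)
      ≤ ((B (n + 1) / (n + 1) : ℝ) : EReal) := by
  have hn1 : (0 : ℝ) < n + 1 := by positivity
  set ν : Measure 𝒵 := μ.map Z with hν
  have : IsProbabilityMeasure ν := Measure.isProbabilityMeasure_map hZ_meas.aemeasurable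
  have hX_all : Measurable fun ω i => X i ω := measurable_pi_lambda _ hX_meas
  have hlaw : μ.map (fun ω => ((fun i => X i ω), Z ω)) =
      (Measure.pi fun _ : Fin n => ν).prod ν := by
    rw [(indepFun_iff_map_prod_eq_prod_map_map hX_all.aemeasurable hZ_meas.aemeasurable).1
      hXZ_indep, (iIndepFun_iff_map_fun_eq_pi_map fun i => (hX_meas i).aemeasurable).1 hX_indep]
    simp only [(hX_ident _).map_eq, hν]
  have hbound : ∀ θ ∈ Θ,
      ∫ ω, ℓ (θn ω) (Z ω) ∂μ - B (n + 1) / (n + 1) ≤ ∫ ω, ℓ θ (Z ω) ∂μ := by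
    intro θ hθ
    have hloss : ∀ y, Measurable (ℓ y) := fun y => hℓ_meas.comp measurable_prodMk_left
    set k : (Fin n → 𝒵) × 𝒵 → ℝ := fun p =>
      ∑ t : Fin (n + 1), (ℓ (m t (NPC.past p.1 (Nat.le_of_lt_succ t.isLt))) p.2 - ℓ θ p.2)
      with hk
    have hk_meas : Measurable k := Finset.measurable_sum _ fun t _ =>
      (hℓ_meas.comp (((hm_meas t).comp ((NPC.measurable_past _).comp measurable_fst)).prodMk
        measurable_snd)).sub ((hloss θ).comp measurable_snd)
    set L : Ω → ℝ := fun ω => (n + 1) * (ℓ (θn ω) (Z ω) - ℓ θ (Z ω)) with hL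
    have hL_int : Integrable L μ := (hθn_int.sub (hΘ_int θ hθ)).const_mul _
    have hLk : ∀ ω, L ω ≤ k ((fun i => X i ω), Z ω) := by
      intro ω
      have := NPC.jensen_barycenter hM (hℓ_lsc (Z ω)) (hℓ_conv (Z ω)) _ _ (hθn ω).sum_dist_sq_le
      simp only [Fintype.card_fin, Nat.cast_add, Nat.cast_one, NPC.predictions] at this
      simp only [hL, hk, Finset.sum_sub_distrib, Finset.sum_const, Finset.card_univ,
        Fintype.card_fin, nsmul_eq_mul, Nat.cast_add, Nat.cast_one]
      linarith
    have hpair : Measurable fun ω => ((fun i => X i ω), Z ω) := hX_all.prodMk hZ_meas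
    have hmain : ∫ ω, L ω ∂μ ≤ B (n + 1) := by
      refine NPC.integral_le_of_integral_min_le hL_int fun c => ?_
      -- `k` is a measurable function of the data, so it can be transported to the product law; `L`
      -- involves `θn`, whose measurability is not given. The cap `c` makes `k` integrable, between
      -- `min L c` and `c`.
      have hmin_meas : Measurable fun p => min (k p) (c : ℝ) := hk_meas.min measurable_const
      have hmin_int : Integrable (fun ω => min (k ((fun i => X i ω), Z ω)) (c : ℝ)) μ :=
        integrable_of_le_of_le (hmin_meas.comp hpair).aestronglyMeasurable
          (Filter.Eventually.of_forall fun ω => min_le_min_right _ (hLk ω))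
          (Filter.Eventually.of_forall fun ω => min_le_right _ _)
          (hL_int.inf (integrable_const _)) (integrable_const _)
      calc ∫ ω, min (L ω) c ∂μ
          ≤ ∫ ω, min (k ((fun i => X i ω), Z ω)) c ∂μ :=
            integral_mono (hL_int.inf (integrable_const _)) hmin_int
              fun ω => min_le_min_right _ (hLk ω)
        _ = ∫ p, min (k p) c ∂((Measure.pi fun _ : Fin n => ν).prod ν) := by
            rw [← hlaw, integral_map hpair.aemeasurable hmin_meas.aestronglyMeasurable]
        _ ≤ B (n + 1) := by
            refine NPC.integral_le_of_partial_sums_le ν (fun t x z => ℓ (m t x) z - ℓ θ z)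
              (fun t x => (hloss _).sub (hloss _)) B
              (fun T hT z => NPC.sum_sub_le_of_regret_le (hregret T hT z) hθ) n _ ?_
              fun x z => min_le_left _ _
            rw [← hlaw, integrable_map_measure hmin_meas.aestronglyMeasurable hpair.aemeasurable]
            exact hmin_int
    rw [hL, integral_const_mul, integral_sub hθn_int (hΘ_int θ hθ)] at hmain
    have : ∫ ω, ℓ (θn ω) (Z ω) ∂μ - ∫ ω, ℓ θ (Z ω) ∂μ ≤ B (n + 1) / (n + 1) := by
      rw [le_div_iff₀ hn1]
      linarith
    linarith
  have hInf : ((∫ ω, ℓ (θn ω) (Z ω) ∂μ - B (n + 1) / (n + 1) : ℝ) : EReal) ≤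
      ⨅ θ ∈ Θ, ((∫ ω, ℓ θ (Z ω) ∂μ : ℝ) : EReal) :=
    le_iInf₂ fun θ hθ => EReal.coe_le_coe_iff.2 (hbound θ hθ)
  refine (EReal.sub_le_sub le_rfl hInf).trans ?_
  rw [← EReal.coe_sub, sub_sub_cancel]
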